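/- Let $\mathbb F_q$ be a finite field with $q$ elements, $A=\mathbb F_q[\theta]$, $K=\mathbb F_q(\theta)$, and let $A_+$ be the set of monic elements of $A$. Let $X_1,\dots,X_s,Z$ be indeterminates and let $\tau$ act by $\tau(G)=G^q$. Let $a\mapsto C_a$ be the Carlitz module, that is, the unique $\mathbb F_q$-algebra homomorphism from $A$ to the twisted polynomial ring $A[\tau]$ with $C_\theta=\theta+\tau$. For a nonzero $a\in A$ and $G\in K[X_1,\dots,X_s][[Z]]$ put $$a*G=G\bigl(C_a(X_1),\dots,C_a(X_s),Z^{q^{\deg_\theta a}}\bigr).$$ Let $D_0=1$ and $D_i=(\theta^{q^i}-\theta)D_{i-1}^q$ for $i\ge1$, and for $G\in K[X_1,\dots,X_s][[Z]]$ with zero constant term in $Z$ let $\exp_C(G)=\sum_{i\ge0}G^{q^i}/D_i$ be the Carlitz exponential. Then for every $F\in A[X_1,\dots,X_s]$ the formal power series $$\mathfrak L(F,Z)=\exp_C\Bigl(\sum_{a\in A_+}\frac{a*(FZ)}{a}\Bigr)\in K[X_1,\dots,X_s][[Z]]$$ is a polynomial with coefficients in $A$, that is, $\mathfrak L(F,Z)\in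 A[X_1,\dots,X_s,Z]$. -/

import Mathlib

noncomputable section

namespace Carlitz

/-- The Carlitz module.  Let `A = 𝔽_q[θ]` (with `θ = Polynomial.X`) and let `R` be an `A`-algebra,
on which `τ` acts by `x ↦ x ^ q`.  This is the unique `𝔽_q`-algebra homomorphism `a ↦ C_a` from `A`
to the `𝔽_q`-linear endomorphisms of `R` with `C_θ = θ + τ`, that is `C_θ x = θ x + x ^ q`. -/
def carlitz (Fq : Type*) [Field Fq] [Fintype Fq] (R : Type*) [CommRing R] [Algebra Fq R]
    [Algebra (Polynomial Fq) R] : Polynomial Fq →ₐ[Fq] Module.End Fq R :=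
  Polynomial.aeval
    (LinearMap.mulLeft Fq (algebraMap (Polynomial Fq) R Polynomial.X) +
      (FiniteField.frobeniusAlgHom Fq R).toLinearMap)

/-- `D_0 = 1` and `D_i = (θ ^ (q ^ i) - θ) * D_{i-1} ^ q` for `i ≥ 1`. -/
def carlitzD (Fq : Type*) [Field Fq] [Fintype Fq] : ℕ → Polynomial Fq
  | 0 => 1
  | i + 1 => (Polynomial.X ^ (Fintype.card Fq ^ (i + 1)) - Polynomial.X) *
      carlitzD Fq i ^ Fintype.card Fq

/-- A family of power series is locally finite if each coefficient is nonzero for only finitely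
many members of the family. -/
def LocallyFinite {ι R : Type*} [CommRing R] (f : ι → PowerSeries R) : Prop :=
  ∀ n : ℕ, {i | PowerSeries.coeff n (f i) ≠ 0}.Finite

/-- The sum of a locally finite family of power series, formed coefficient by coefficient. -/
def formalSum {ι R : Type*} [CommRing R] (f : ι → PowerSeries R) : PowerSeries R :=
  PowerSeries.mk fun n => ∑ᶠ i, PowerSeries.coeff n (f i)

/-- The action of (nonzero) `a ∈ A` on `G ∈ K[X_1, …, X_s][[Z]]`, where `K = 𝔽_q(θ)`:
`a * G = G(C_a(X_1), …, C_a(X_s), Z ^ (q ^ deg a))`. -/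
def star {Fq : Type*} [Field Fq] [Fintype Fq] {s : ℕ} (a : Polynomial Fq)
    (G : PowerSeries (MvPolynomial (Fin s) (RatFunc Fq))) :
    PowerSeries (MvPolynomial (Fin s) (RatFunc Fq)) :=
  PowerSeries.expand (Fintype.card Fq ^ a.natDegree) (pow_ne_zero _ Fintype.card_ne_zero)
    (PowerSeries.map
      (MvPolynomial.aeval fun j : Fin s =>
        carlitz Fq (MvPolynomial (Fin s) (RatFunc Fq)) a (MvPolynomial.X j)).toRingHom G)

/-- The terms `a * (F Z) / a`, for `a` monic in `A`, of the series `l(F, Z)`. -/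
def lTerm {Fq : Type*} [Field Fq] [Fintype Fq] {s : ℕ}
    (F : MvPolynomial (Fin s) (RatFunc Fq)) (a : {a : Polynomial Fq // a.Monic}) :
    PowerSeries (MvPolynomial (Fin s) (RatFunc Fq)) :=
  (algebraMap (Polynomial Fq) (RatFunc Fq) a.1)⁻¹ •
    star a.1 (PowerSeries.C F * PowerSeries.X)

/-- `l(F, Z) = ∑_{a ∈ A monic} a * (F Z) / a ∈ K[X_1, …, X_s][[Z]]`. -/
def lSeries {Fq : Type*} [Field Fq] [Fintype Fq] {s : ℕ}
    (F : MvPolynomial (Fin s) (RatFunc Fq)) :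
    PowerSeries (MvPolynomial (Fin s) (RatFunc Fq)) :=
  formalSum (lTerm F)

/-- The terms `τ ^ i (G) / D_i = G ^ (q ^ i) / D_i` of the Carlitz exponential of `G`. -/
def expTerm {Fq : Type*} [Field Fq] [Fintype Fq] {s : ℕ}
    (G : PowerSeries (MvPolynomial (Fin s) (RatFunc Fq))) (i : ℕ) :
    PowerSeries (MvPolynomial (Fin s) (RatFunc Fq)) :=
  (algebraMap (Polynomial Fq) (RatFunc Fq) (carlitzD Fq i))⁻¹ • G ^ (Fintype.card Fq ^ i)

/-- The Carlitz exponential `exp_C(G) = ∑_{i ≥ 0} G ^ (q ^ i) / D_i` of a series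
`G ∈ K[X_1, …, X_s][[Z]]` with zero constant term in `Z`. -/
def expC {Fq : Type*} [Field Fq] [Fintype Fq] {s : ℕ}
    (G : PowerSeries (MvPolynomial (Fin s) (RatFunc Fq))) :
    PowerSeries (MvPolynomial (Fin s) (RatFunc Fq)) :=
  formalSum (expTerm G)

/-- `𝔏(F, Z) = exp_C(l(F, Z))`. -/
def logAlg {Fq : Type*} [Field Fq] [Fintype Fq] {s : ℕ}
    (F : MvPolynomial (Fin s) (RatFunc Fq)) :
    PowerSeries (MvPolynomial (Fin s) (RatFunc Fq)) :=
  expC (lSeries F)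

/-- `a * (F Z) = F(C_a(X_1), …, C_a(X_s)) Z ^ (q ^ deg a)`. -/
theorem star_C_mul_X {Fq : Type*} [Field Fq] [Fintype Fq] {s : ℕ} (a : Polynomial Fq)
    (F : MvPolynomial (Fin s) (RatFunc Fq)) :
    star a (PowerSeries.C F * PowerSeries.X) =
      PowerSeries.C (MvPolynomial.aeval (fun j : Fin s =>
        carlitz Fq (MvPolynomial (Fin s) (RatFunc Fq)) a (MvPolynomial.X j)) F) *
      PowerSeries.X ^ (Fintype.card Fq ^ a.natDegree) := by
  simp [star, PowerSeries.expand_C, PowerSeries.expand_X]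

/-- The sum defining `l(F, Z)` is locally finite. -/
theorem locallyFinite_lTerm {Fq : Type*} [Field Fq] [Fintype Fq] {s : ℕ}
    (F : MvPolynomial (Fin s) (RatFunc Fq)) : LocallyFinite (lTerm F) := by
  intro n
  have hq : 1 < Fintype.card Fq := Fintype.one_lt_card
  have hfin : {p : Polynomial Fq | p.degree < ((n + 1 : ℕ) : WithBot ℕ)}.Finite := by
    have : Finite (Polynomial.degreeLT Fq (n + 1)) :=
      Finite.of_equiv _ (Polynomial.degreeLTEquiv Fq (n + 1)).symm.toEquiv
    refine (Set.toFinite (Polynomial.degreeLT Fq (n + 1) : Set (Polynomial Fq))).subset ?_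
    intro p hp
    exact Polynomial.mem_degreeLT.2 hp
  refine (hfin.preimage Subtype.val_injective.injOn).subset ?_
  intro a ha
  simp only [Set.mem_ofPred_eq, lTerm, star_C_mul_X, PowerSeries.coeff_smul,
    PowerSeries.coeff_C_mul, PowerSeries.coeff_X_pow] at ha
  have hn : n = Fintype.card Fq ^ a.1.natDegree := by
    by_contra h
    simp [h] at ha
  have hlt : a.1.natDegree < n := hn ▸ Nat.lt_pow_self hq
  simp only [Set.mem_preimage, Set.mem_ofPred_eq]
  refine lt_of_le_of_lt Polynomial.degree_le_natDegree ?_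
  exact_mod_cast (by omega : a.1.natDegree < n + 1)

/-- The constant term in `Z` of `l(F, Z)` is zero. -/
theorem constantCoeff_lSeries {Fq : Type*} [Field Fq] [Fintype Fq] {s : ℕ}
    (F : MvPolynomial (Fin s) (RatFunc Fq)) :
    PowerSeries.constantCoeff (lSeries F) = 0 := by
  rw [← PowerSeries.coeff_zero_eq_constantCoeff_apply, lSeries, formalSum, PowerSeries.coeff_mk]
  refine finsum_eq_zero_of_forall_eq_zero fun a => ?_
  have h : (0 : ℕ) ≠ Fintype.card Fq ^ a.1.natDegree :=
    (pow_ne_zero _ Fintype.card_ne_zero).symm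
  simp only [lTerm, star_C_mul_X, PowerSeries.coeff_smul,
    PowerSeries.coeff_C_mul, PowerSeries.coeff_X_pow, if_neg h, mul_zero, smul_zero]

/-- The sum defining `exp_C(G)` is locally finite if `G` has zero constant term. -/
theorem locallyFinite_expTerm {Fq : Type*} [Field Fq] [Fintype Fq] {s : ℕ}
    (G : PowerSeries (MvPolynomial (Fin s) (RatFunc Fq)))
    (hG : PowerSeries.constantCoeff G = 0) : LocallyFinite (expTerm G) := by
  intro n
  refine (Set.finite_le_nat n).subset ?_
  intro i hi
  by_contra h
  have hni : n < i := not_le.1 h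
  have hq : 1 < Fintype.card Fq := Fintype.one_lt_card
  have hlt : n < Fintype.card Fq ^ i := hni.trans (Nat.lt_pow_self hq)
  have hd : (PowerSeries.X : PowerSeries (MvPolynomial (Fin s) (RatFunc Fq))) ^
      (Fintype.card Fq ^ i) ∣ G ^ (Fintype.card Fq ^ i) :=
    pow_dvd_pow_of_dvd (PowerSeries.X_dvd_iff.2 hG) _
  have h0 := PowerSeries.X_pow_dvd_iff.1 hd n hlt
  simp [expTerm, h0] at hi

end Carlitz

end

/-! Only powers `Z ^ (q ^ k)` occur in 𝔏(F, Z), and the coefficient there is `f_k = ∑_{i+j=k} S_j ^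
(q ^ i) / D_i`, where `S_j` is the sum of `F(C_a(X)) / a` over the monic `a` of degree `j`
(`coeff_logAlg`). So it suffices that every `f_k` has coefficients in `A` and that `f_k = 0` for
large `k`.

Integrality (`expSeq_starSum_integral`) is proved at one monic prime `P` of degree `d` at a time, by
Dwork's method. Splitting the `a` by divisibility by `P` gives `P S = P * S + P u` with `u` integral
at `P`. Applying `exp_C` turns this into `C_P(f) - P * f = exp_C(P u)`, which is divisible by `P`
because `D_i` has `P`-valuation at most `q ^ i - 1`. Since `C_P` reduces to `τ ^ d` modulo `P`, the
operation `P *` lifts a power of Frobenius, and the congruence yields `f_k` from the earlier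
coefficients.

Vanishing (`expSeq_starSum_eventually_eq_zero`) is proved by evaluating `f_k` at `θ`-power torsion
points of the Carlitz module. At a place over `∞` these points are bounded and `C_a` preserves them,
so the denominators `a` and `D_i` make the value smaller than 1 once `k` is large. At all other
places the value is integral. Such an element is 0, and a polynomial that vanishes on a power of an
infinite set is 0. -/

section

open Polynomial
open scoped Pointwise

namespace Carlitz

/-! ### The coefficients of the twisted polynomials `C_a`. -/

section Twisted

variable {Fq : Type*} [Field Fq]

/-- The endomorphism `θ + τ` of an `A`-module with an `𝔽_q`-linear endomorphism `τ`. -/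
noncomputable def thetaAddTau {M : Type*} [AddCommGroup M] [Module Fq M] [Module Fq[X] M]
    [IsScalarTower Fq Fq[X] M] (τ : Module.End Fq M) : Module.End Fq M :=
  Algebra.lsmul Fq Fq M (X : Fq[X]) + τ

theorem thetaAddTau_apply {M : Type*} [AddCommGroup M] [Module Fq M] [Module Fq[X] M]
    [IsScalarTower Fq Fq[X] M] (τ : Module.End Fq M) (m : M) :
    thetaAddTau τ m = (X : Fq[X]) • m + τ m := rfl

theorem C_smul_eq {M : Type*} [AddCommGroup M] [Module Fq M] [Module Fq[X] M]
    [IsScalarTower Fq Fq[X] M] (r : Fq) (m : M) : (C r : Fq[X]) • m = r • m := by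
  rw [← algebraMap_eq, algebraMap_smul]

variable [Fintype Fq]

theorem carlitz_eq_aeval {R : Type*} [CommRing R] [Algebra Fq R] [Algebra Fq[X] R]
    [IsScalarTower Fq Fq[X] R] (a : Fq[X]) :
    carlitz Fq R a = aeval (thetaAddTau (FiniteField.frobeniusAlgHom Fq R).toLinearMap) a := by
  rw [carlitz]
  congr 2
  ext x
  simp [thetaAddTau_apply, Algebra.smul_def]

/-- On sequences, the operator `τ` with `(τ f)_0 = 0` and `(τ f)_{k+1} = f_k ^ q`. -/
def seqTau (Fq : Type*) [Field Fq] [Fintype Fq] (R : Type*) [CommRing R] [Algebra Fq R] :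
    Module.End Fq (ℕ → R) where
  toFun f k := Nat.casesOn k 0 fun k => FiniteField.frobeniusAlgHom Fq R (f k)
  map_add' f g := by ext (_ | k) <;> simp [-FiniteField.frobeniusAlgHom_apply]
  map_smul' c f := by ext (_ | k) <;> simp [-FiniteField.frobeniusAlgHom_apply]

@[simp] theorem seqTau_zero {R : Type*} [CommRing R] [Algebra Fq R] (f : ℕ → R) :
    seqTau Fq R f 0 = 0 := rfl

@[simp] theorem seqTau_succ {R : Type*} [CommRing R] [Algebra Fq R] (f : ℕ → R) (k : ℕ) :
    seqTau Fq R f (k + 1) = f k ^ Fintype.card Fq := rfl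

theorem seqTau_smul {R : Type*} [CommRing R] [Algebra Fq R] [Algebra Fq[X] R]
    (a : Fq[X]) (f : ℕ → R) :
    seqTau Fq R (a • f) = a ^ Fintype.card Fq • seqTau Fq R f := by
  ext (_ | k) <;> simp [Algebra.smul_def, mul_pow]

theorem seqTau_pow_apply {R : Type*} [CommRing R] [Algebra Fq R] (f : ℕ → R) (i k : ℕ) :
    (seqTau Fq R ^ i) f k = if i ≤ k then f (k - i) ^ Fintype.card Fq ^ i else 0 := by
  induction i generalizing k with
  | zero => simp
  | succ i ih =>
    rw [pow_succ', Module.End.mul_apply]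
    cases k with
    | zero => simp
    | succ k =>
      rw [seqTau_succ, ih]
      by_cases h : i ≤ k
      · simp [h, pow_succ, pow_mul]
      · simp [h, Fintype.card_ne_zero]

/-- The coefficients of `C_a = ∑ c_i τ ^ i`. -/
noncomputable def carlitzCoeff (a : Fq[X]) : ℕ → Fq[X] :=
  aeval (thetaAddTau (seqTau Fq Fq[X])) a (Pi.single 0 1 : ℕ → Fq[X])

theorem carlitzCoeff_add (a b : Fq[X]) :
    carlitzCoeff (a + b) = carlitzCoeff a + carlitzCoeff b := by
  simp [carlitzCoeff]

theorem carlitzCoeff_C (r : Fq) : carlitzCoeff (C r) = (Pi.single 0 (C r) : ℕ → Fq[X]) := by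
  rw [carlitzCoeff, aeval_C, Module.algebraMap_end_apply]
  ext i : 1
  by_cases h : i = 0
  · subst h; simp [smul_eq_C_mul]
  · simp [h]

theorem carlitzCoeff_X_mul (a : Fq[X]) :
    carlitzCoeff (X * a) = (X : Fq[X]) • carlitzCoeff a + seqTau Fq Fq[X] (carlitzCoeff a) := by
  rw [carlitzCoeff, map_mul, aeval_X, Module.End.mul_apply, thetaAddTau_apply]
  rfl

theorem carlitzCoeff_X_mul_zero (a : Fq[X]) : carlitzCoeff (X * a) 0 = X * carlitzCoeff a 0 := by
  simp [carlitzCoeff_X_mul]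

theorem carlitzCoeff_X_mul_succ (a : Fq[X]) (i : ℕ) :
    carlitzCoeff (X * a) (i + 1) =
      X * carlitzCoeff a (i + 1) + carlitzCoeff a i ^ Fintype.card Fq := by
  simp [carlitzCoeff_X_mul]

theorem carlitzCoeff_zero (a : Fq[X]) : carlitzCoeff a 0 = a := by
  induction a using Polynomial.induction_on' with
  | add p q hp hq => rw [carlitzCoeff_add, Pi.add_apply, hp, hq]
  | monomial n r =>
    induction n with
    | zero => rw [monomial_zero_left, carlitzCoeff_C, Pi.single_eq_same]
    | succ n ih => rw [← X_mul_monomial, carlitzCoeff_X_mul_zero, ih]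

theorem add_pow_card {R : Type*} [CommRing R] [Algebra Fq R] (x y : R) :
    (x + y) ^ Fintype.card Fq = x ^ Fintype.card Fq + y ^ Fintype.card Fq :=
  map_add (FiniteField.frobeniusAlgHom Fq R) x y

/-- The coefficients of `C_a C_θ`. -/
theorem carlitzCoeff_X_mul_succ' (a : Fq[X]) (i : ℕ) :
    carlitzCoeff (X * a) (i + 1) =
      X ^ Fintype.card Fq ^ (i + 1) * carlitzCoeff a (i + 1) + carlitzCoeff a i := by
  induction a using Polynomial.induction_on' generalizing i with
  | add p q hp hq =>
    rw [mul_add, carlitzCoeff_add, carlitzCoeff_add, Pi.add_apply, hp, hq]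
    simp only [Pi.add_apply]
    ring
  | monomial n r =>
    induction n generalizing i with
    | zero =>
      rw [monomial_zero_left, carlitzCoeff_X_mul_succ, carlitzCoeff_C]
      cases i with
      | zero => simp [← C_pow, FiniteField.pow_card]
      | succ i => simp [Fintype.card_ne_zero]
    | succ n ih =>
      rw [← X_mul_monomial, carlitzCoeff_X_mul_succ]
      have h := carlitzCoeff_X_mul_succ (monomial n r) i
      -- For positive `i` this is the inductive hypothesis at `i - 1` raised to the `q`-th power,
      -- the bracket being the `q`-th power of the preceding coefficient. For `i = 0` the bracket
      -- vanishes.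
      suffices h' : carlitzCoeff (X * monomial n r) i ^ Fintype.card Fq =
          X ^ Fintype.card Fq ^ (i + 1) * carlitzCoeff (monomial n r) i ^ Fintype.card Fq +
            (carlitzCoeff (X * monomial n r) i - X * carlitzCoeff (monomial n r) i) by
        linear_combination X * ih i - X ^ Fintype.card Fq ^ (i + 1) * h + h'
      cases i with
      | zero => rw [carlitzCoeff_X_mul_zero, mul_pow]; ring
      | succ i =>
        rw [carlitzCoeff_X_mul_succ, add_sub_cancel_left, ← carlitzCoeff_X_mul_succ, ih,
          add_pow_card, mul_pow, ← pow_mul, ← pow_succ]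

/-- Horner's scheme `a = θ * divX a + a_0`: each step raises the degree in `τ` by one and replaces
the top coefficient by its `q`-th power, which fixes elements of `𝔽_q`. -/
theorem carlitzCoeff_of_natDegree_le {n : ℕ} {a : Fq[X]} (ha : a.natDegree ≤ n) :
    carlitzCoeff a n = C (a.coeff n) ∧ ∀ i, n < i → carlitzCoeff a i = 0 := by
  induction n generalizing a with
  | zero =>
    rw [eq_C_of_natDegree_le_zero ha, carlitzCoeff_C]
    refine ⟨by simp, fun i hi => Pi.single_eq_of_ne (M := fun _ => Fq[X]) hi.ne' _⟩
  | succ n ih =>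
    have hb : a.divX.natDegree ≤ n := by rw [natDegree_divX_eq_natDegree_tsub_one]; omega
    obtain ⟨h1, h2⟩ := ih hb
    have key : ∀ i, carlitzCoeff a (i + 1) =
        X * carlitzCoeff a.divX (i + 1) + carlitzCoeff a.divX i ^ Fintype.card Fq := by
      intro i
      conv_lhs => rw [← X_mul_divX_add a]
      rw [carlitzCoeff_add, Pi.add_apply, carlitzCoeff_X_mul_succ, carlitzCoeff_C]
      simp
    refine ⟨?_, ?_⟩
    · rw [key, h2 _ n.lt_succ_self, h1, ← C_pow, FiniteField.pow_card, coeff_divX]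
      simp
    · rintro (_ | i) hi
      · omega
      · rw [key, h2 _ (by omega), h2 _ (by omega)]
        simp [Fintype.card_ne_zero]

/-- `C_a = ∑ c_i τ ^ i`. -/
theorem aeval_thetaAddTau_apply {M : Type*} [AddCommGroup M] [Module Fq M] [Module Fq[X] M]
    [IsScalarTower Fq Fq[X] M] (τ : Module.End Fq M)
    (hτ : ∀ (a : Fq[X]) (m : M), τ (a • m) = a ^ Fintype.card Fq • τ m)
    {n : ℕ} {a : Fq[X]} (ha : a.natDegree ≤ n) (m : M) :
    aeval (thetaAddTau τ) a m =
      ∑ i ∈ Finset.range (n + 1), carlitzCoeff a i • (τ ^ i) m := by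
  induction n generalizing a with
  | zero =>
    rw [eq_C_of_natDegree_le_zero ha, carlitzCoeff_C]
    simp [Module.algebraMap_end_apply, C_smul_eq]
  | succ n ih =>
    have hb : a.divX.natDegree ≤ n := by rw [natDegree_divX_eq_natDegree_tsub_one]; omega
    have h0 := (carlitzCoeff_of_natDegree_le hb).2 (n + 1) n.lt_succ_self
    conv_lhs => rw [← X_mul_divX_add a]
    rw [map_add, map_mul, aeval_X, LinearMap.add_apply, Module.End.mul_apply, ih hb, aeval_C,
      Module.algebraMap_end_apply, thetaAddTau_apply, map_sum, Finset.smul_sum]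
    have h1 : ∑ i ∈ Finset.range (n + 1), (X : Fq[X]) • carlitzCoeff a.divX i • (τ ^ i) m =
        ∑ i ∈ Finset.range (n + 1 + 1), (X * carlitzCoeff a.divX i) • (τ ^ i) m := by
      rw [Finset.sum_range_succ _ (n + 1), h0]
      simp [mul_smul]
    have h2 : ∀ i, carlitzCoeff a (i + 1) =
        X * carlitzCoeff a.divX (i + 1) + carlitzCoeff a.divX i ^ Fintype.card Fq := by
      intro i
      conv_lhs => rw [← X_mul_divX_add a]
      rw [carlitzCoeff_add, Pi.add_apply, carlitzCoeff_X_mul_succ, carlitzCoeff_C]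
      simp
    have h3 : carlitzCoeff a 0 = X * carlitzCoeff a.divX 0 + C (a.coeff 0) := by
      simp only [carlitzCoeff_zero, X_mul_divX_add]
    rw [h1, Finset.sum_range_succ' _ (n + 1), Finset.sum_range_succ' _ (n + 1), h3]
    simp only [h2, add_smul, Finset.sum_add_distrib, hτ, pow_succ', Module.End.mul_apply, pow_zero,
      Module.End.one_apply]
    rw [C_smul_eq]
    abel

/-- Comparing `C_P C_θ` with `C_θ C_P` gives `(θ ^ (q ^ (i + 1)) - θ) c_{i+1} = c_i ^ q - c_i`. The
first factor is prime to `P` as long as `i + 1 < deg P`, so divisibility passes from `c_0 = P`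
upwards. For monic `P` this means `C_P ≡ τ ^ (deg P)` modulo `P`. -/
theorem dvd_carlitzCoeff {P : Fq[X]} (hP : Irreducible P) {i : ℕ} (hi : i < P.natDegree) :
    P ∣ carlitzCoeff P i := by
  induction i with
  | zero => rw [carlitzCoeff_zero]
  | succ i ih =>
    have h := (carlitzCoeff_X_mul_succ' P i).symm.trans (carlitzCoeff_X_mul_succ P i)
    have h1 : (X ^ Fintype.card Fq ^ (i + 1) - X) * carlitzCoeff P (i + 1) =
        carlitzCoeff P i ^ Fintype.card Fq - carlitzCoeff P i := by
      linear_combination h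
    have h2 : P ∣ (X ^ Fintype.card Fq ^ (i + 1) - X) * carlitzCoeff P (i + 1) := by
      rw [h1]
      exact dvd_sub (dvd_pow (ih (by omega)) Fintype.card_ne_zero) (ih (by omega))
    refine (hP.prime.dvd_or_dvd h2).resolve_left fun h3 => ?_
    rw [← Nat.card_eq_fintype_card] at h3
    have := Nat.le_of_dvd (Nat.succ_pos i) (hP.natDegree_dvd_of_dvd_X_pow_card_pow_sub_X h3)
    omega

theorem carlitz_apply {R : Type*} [CommRing R] [Algebra Fq R] [Algebra Fq[X] R]
    [IsScalarTower Fq Fq[X] R] (a : Fq[X]) (x : R) :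
    carlitz Fq R a x =
      ∑ i ∈ Finset.range (a.natDegree + 1), carlitzCoeff a i • x ^ Fintype.card Fq ^ i := by
  rw [carlitz_eq_aeval, aeval_thetaAddTau_apply _ _ le_rfl]
  · refine Finset.sum_congr rfl fun i _ => ?_
    congr 1
    clear * -
    induction i with
    | zero => simp
    | succ i ih =>
      rw [pow_succ', Module.End.mul_apply, ih]
      simp [pow_succ, pow_mul]
  · intro a x
    simp [Algebra.smul_def, mul_pow]

end Twisted

/-! ### The substitutions `X_j ↦ C_a(X_j)` and the Frobenius lift. -/

section Substitution

variable {Fq : Type*} [Field Fq] [Fintype Fq]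

theorem map_carlitz {R S : Type*} [CommRing R] [Algebra Fq R] [Algebra Fq[X] R]
    [IsScalarTower Fq Fq[X] R] [CommRing S] [Algebra Fq S] [Algebra Fq[X] S]
    [IsScalarTower Fq Fq[X] S] (f : R →ₐ[Fq[X]] S) (a : Fq[X]) (x : R) :
    f (carlitz Fq R a x) = carlitz Fq S a (f x) := by
  simp only [carlitz_apply, map_sum, map_smul, map_pow]

/-- The substitution `X_j ↦ C_a(X_j)`. -/
noncomputable def carlitzSubst {σ : Type*} (B : Type*) [CommRing B] [Algebra Fq B] [Algebra Fq[X] B]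
    (a : Fq[X]) : MvPolynomial σ B →ₐ[B] MvPolynomial σ B :=
  MvPolynomial.aeval fun j => carlitz Fq (MvPolynomial σ B) a (MvPolynomial.X j)

variable {σ : Type*} {B : Type*} [CommRing B] [Algebra Fq B] [Algebra Fq[X] B]

@[simp] theorem carlitzSubst_X (a : Fq[X]) (j : σ) :
    carlitzSubst B a (MvPolynomial.X j) = carlitz Fq (MvPolynomial σ B) a (MvPolynomial.X j) :=
  MvPolynomial.aeval_X _ _

@[simp] theorem carlitzSubst_C (a : Fq[X]) (c : B) :
    carlitzSubst B a (MvPolynomial.C c : MvPolynomial σ B) = MvPolynomial.C c :=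
  (carlitzSubst B a).commutes c

variable [IsScalarTower Fq Fq[X] B]

theorem carlitzSubst_mul (a b : Fq[X]) (x : MvPolynomial σ B) :
    carlitzSubst B (a * b) x = carlitzSubst B a (carlitzSubst B b x) := by
  rw [← AlgHom.comp_apply]
  congr 1
  refine MvPolynomial.algHom_ext fun j => ?_
  have h := map_carlitz ((carlitzSubst B a : MvPolynomial σ B →ₐ[B] _).restrictScalars Fq[X]) b
    (MvPolynomial.X j)
  simp only [AlgHom.restrictScalars_apply] at h
  -- The composite substitution sends `X_j` to `C_b(C_a(X_j))`, in the opposite order; hence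
  -- `mul_comm`.
  rw [AlgHom.comp_apply, carlitzSubst_X, carlitzSubst_X, h, carlitzSubst_X, mul_comm, map_mul,
    Module.End.mul_apply]

theorem mapAlgHom_carlitzSubst {B' : Type*} [CommRing B'] [Algebra Fq B'] [Algebra Fq[X] B']
    [IsScalarTower Fq Fq[X] B'] (g : B →ₐ[Fq[X]] B') (a : Fq[X]) (x : MvPolynomial σ B) :
    MvPolynomial.mapAlgHom g (carlitzSubst B a x) =
      carlitzSubst B' a (MvPolynomial.mapAlgHom g x) := by
  induction x using MvPolynomial.induction_on with
  | C c =>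
    rw [carlitzSubst_C]
    simp [MvPolynomial.mapAlgHom_apply, ← RingHom.comp_apply]
  | add p q hp hq => simp only [map_add, hp, hq]
  | mul_X p j hp =>
    rw [map_mul, map_mul, map_mul, map_mul, hp]
    congr 1
    have h : MvPolynomial.mapAlgHom (σ := σ) g (MvPolynomial.X j) = MvPolynomial.X j := by
      simp [MvPolynomial.mapAlgHom_apply]
    rw [h, carlitzSubst_X, carlitzSubst_X, map_carlitz, h]

theorem frobeniusAlgHom_pow_apply {R : Type*} [CommRing R] [Algebra Fq R] (d : ℕ) (x : R) :
    (FiniteField.frobeniusAlgHom Fq R ^ d) x = x ^ Fintype.card Fq ^ d := by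
  induction d with
  | zero => simp
  | succ d ih => rw [pow_succ', AlgHom.mul_apply, ih]; simp [pow_succ, pow_mul]

theorem add_pow_card_pow {R : Type*} [CommRing R] [Algebra Fq R] (d : ℕ) (x y : R) :
    (x + y) ^ Fintype.card Fq ^ d = x ^ Fintype.card Fq ^ d + y ^ Fintype.card Fq ^ d := by
  simp only [← frobeniusAlgHom_pow_apply, map_add]

/-- If `B` is a localization of `A`, then `X_j ↦ C_P(X_j)` lifts the `q ^ d`-power Frobenius
modulo `P`, where `P` is a monic prime of degree `d`. -/
theorem exists_carlitzSubst_eq_pow_add {P : Fq[X]} (hP : Irreducible P) (hm : P.Monic)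
    (M : Submonoid Fq[X]) [IsLocalization M B] (x : MvPolynomial σ B) :
    ∃ y, carlitzSubst B P x = x ^ Fintype.card Fq ^ P.natDegree + P • y := by
  let I : Ideal (MvPolynomial σ B) := Ideal.span {algebraMap Fq[X] (MvPolynomial σ B) P}
  suffices h : Ideal.Quotient.mk I (carlitzSubst B P x) =
      Ideal.Quotient.mk I (x ^ Fintype.card Fq ^ P.natDegree) by
    rw [Ideal.Quotient.mk_eq_mk_iff_sub_mem, Ideal.mem_span_singleton'] at h
    obtain ⟨y, hy⟩ := h
    exact ⟨y, by rw [Algebra.smul_def, mul_comm, hy]; ring⟩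
  have hsmul : ∀ (a : Fq[X]) (y : MvPolynomial σ B), P ∣ a → Ideal.Quotient.mk I (a • y) = 0 := by
    rintro a y ⟨b, rfl⟩
    rw [Ideal.Quotient.eq_zero_iff_mem, mul_smul, Algebra.smul_def]
    exact Ideal.mul_mem_right _ _ (Ideal.mem_span_singleton_self _)
  rw [← frobeniusAlgHom_pow_apply]
  -- Modulo `P` both sides are ring homomorphisms, so it is enough to compare them on `𝔽_q`, on `θ`
  -- (where `P` divides `θ ^ (q ^ d) - θ`) and on the `X_j` (where `dvd_carlitzCoeff` applies). The
  -- localization `B` needs no further check.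
  suffices h : (Ideal.Quotient.mk I).comp (carlitzSubst B P : MvPolynomial σ B →ₐ[B] _).toRingHom =
      (Ideal.Quotient.mk I).comp
        (FiniteField.frobeniusAlgHom Fq (MvPolynomial σ B) ^ P.natDegree).toRingHom from
    RingHom.congr_fun h x
  refine MvPolynomial.ringHom_ext' (IsLocalization.ringHom_ext M (Polynomial.ringHom_ext ?_ ?_)) ?_
  · intro r
    have h : (MvPolynomial.C (algebraMap Fq[X] B (C r)) : MvPolynomial σ B) =
        algebraMap Fq (MvPolynomial σ B) r := by
      rw [← algebraMap_eq, ← IsScalarTower.algebraMap_apply, MvPolynomial.algebraMap_apply]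
    simp only [RingHom.comp_apply, AlgHom.toRingHom_eq_coe, RingHom.coe_coe]
    rw [carlitzSubst_C, h, AlgHom.commutes]
  · simp only [RingHom.comp_apply, AlgHom.toRingHom_eq_coe, RingHom.coe_coe]
    rw [carlitzSubst_C, frobeniusAlgHom_pow_apply, eq_comm, ← sub_eq_zero, ← map_sub, ← map_pow, ← map_pow,
      ← map_sub, ← map_sub]
    have h := hsmul (X ^ Fintype.card Fq ^ P.natDegree - X) 1 (by
      rw [← Nat.card_eq_fintype_card, ← hP.natDegree_dvd_iff_dvd_X_pow_card_pow_sub_X])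
    rw [Algebra.smul_def, mul_one] at h
    exact h
  · intro j
    simp only [RingHom.comp_apply, AlgHom.toRingHom_eq_coe, RingHom.coe_coe]
    rw [carlitzSubst_X, frobeniusAlgHom_pow_apply, carlitz_apply,
      Finset.sum_range_succ, (carlitzCoeff_of_natDegree_le le_rfl).1, hm.coeff_natDegree, C_1,
      one_smul, map_add, map_sum, Finset.sum_eq_zero, zero_add]
    intro i hi
    exact hsmul _ _ (dvd_carlitzCoeff hP (Finset.mem_range.1 hi))

end Substitution

/-! ### The Carlitz exponential on series in the powers `Z ^ (q ^ k)`. -/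

section Exponential

variable {Fq : Type*} [Field Fq] [Fintype Fq]

theorem X_pow_card_pow_sub_X_ne_zero (i : ℕ) :
    (X ^ Fintype.card Fq ^ (i + 1) - X : Fq[X]) ≠ 0 :=
  FiniteField.X_pow_card_pow_sub_X_ne_zero Fq i.succ_ne_zero Fintype.one_lt_card

theorem carlitzD_succ (i : ℕ) : carlitzD Fq (i + 1) =
    (X ^ Fintype.card Fq ^ (i + 1) - X) * carlitzD Fq i ^ Fintype.card Fq := rfl

theorem carlitzD_ne_zero (i : ℕ) : carlitzD Fq i ≠ 0 := by
  induction i with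
  | zero => exact one_ne_zero
  | succ i ih =>
    rw [carlitzD_succ]
    exact mul_ne_zero (X_pow_card_pow_sub_X_ne_zero i) (pow_ne_zero _ ih)

/-- `1 / D_i`. -/
noncomputable def invD (Fq : Type*) [Field Fq] [Fintype Fq] (i : ℕ) : RatFunc Fq :=
  (algebraMap Fq[X] (RatFunc Fq) (carlitzD Fq i))⁻¹

/-- The recursion for `D_i` in the form in which the functional equation `exp_C(θ G) =
C_θ(exp_C(G))` uses it, coefficient by coefficient. -/
theorem invD_succ (i : ℕ) :
    algebraMap Fq[X] (RatFunc Fq) (X ^ Fintype.card Fq ^ (i + 1)) * invD Fq (i + 1) =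
      algebraMap Fq[X] (RatFunc Fq) X * invD Fq (i + 1) + invD Fq i ^ Fintype.card Fq := by
  have h1 : algebraMap Fq[X] (RatFunc Fq) (carlitzD Fq i) ≠ 0 := by
    simpa using carlitzD_ne_zero i
  have h2 : algebraMap Fq[X] (RatFunc Fq) (X ^ Fintype.card Fq ^ (i + 1) - X) ≠ 0 := by
    rw [ne_eq, FaithfulSMul.algebraMap_eq_zero_iff]
    exact X_pow_card_pow_sub_X_ne_zero i
  rw [← sub_eq_iff_eq_add', ← sub_mul, ← map_sub, invD, invD, carlitzD_succ, map_mul, map_pow,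
    mul_inv, ← mul_assoc, mul_inv_cancel₀ h2, one_mul, inv_pow]

variable {σ : Type*}

/-- The Carlitz exponential on sequences: the sequence `g` stands for the series
`∑ g_k Z ^ (q ^ k)`. -/
noncomputable def expSeq (Fq : Type*) [Field Fq] [Fintype Fq] (σ : Type*) :
    Module.End Fq (ℕ → MvPolynomial σ (RatFunc Fq)) where
  toFun g k := ∑ p ∈ Finset.HasAntidiagonal.antidiagonal k, invD Fq p.1 • g p.2 ^ Fintype.card Fq ^ p.1
  map_add' f g := by
    ext1 k
    simp only [Pi.add_apply, add_pow_card_pow, smul_add, Finset.sum_add_distrib]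
  map_smul' c f := by
    ext1 k
    simp only [Pi.smul_apply, _root_.smul_pow, FiniteField.pow_card_pow, Finset.smul_sum,
      RingHom.id_apply]
    exact Finset.sum_congr rfl fun _ _ => smul_comm _ _ _

theorem expSeq_apply (g : ℕ → MvPolynomial σ (RatFunc Fq)) (k : ℕ) :
    expSeq Fq σ g k =
      ∑ p ∈ Finset.HasAntidiagonal.antidiagonal k, invD Fq p.1 • g p.2 ^ Fintype.card Fq ^ p.1 := rfl

theorem expSeq_X_smul (g : ℕ → MvPolynomial σ (RatFunc Fq)) :
    expSeq Fq σ ((X : Fq[X]) • g) =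
      thetaAddTau (seqTau Fq (MvPolynomial σ (RatFunc Fq))) (expSeq Fq σ g) := by
  rw [thetaAddTau_apply]
  have hsm : ∀ (a : Fq[X]) (c : RatFunc Fq) (x : MvPolynomial σ (RatFunc Fq)),
      a • c • x = (algebraMap Fq[X] (RatFunc Fq) a * c) • x := by
    intro a c x
    rw [mul_smul, algebraMap_smul]
  have hsm' : ∀ (a : Fq[X]) (c : RatFunc Fq) (x : MvPolynomial σ (RatFunc Fq)),
      c • a • x = (algebraMap Fq[X] (RatFunc Fq) a * c) • x := by
    intro a c x
    rw [smul_comm, hsm]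
  ext1 k
  cases k with
  | zero => simp [expSeq_apply, hsm, hsm']
  | succ k =>
    simp only [Pi.add_apply, Pi.smul_apply, seqTau_succ, expSeq_apply,
      Finset.Nat.sum_antidiagonal_succ, Finset.smul_sum, smul_add, _root_.smul_pow]
    have hs : (∑ p ∈ Finset.HasAntidiagonal.antidiagonal k,
        invD Fq p.1 • g p.2 ^ Fintype.card Fq ^ p.1) ^ Fintype.card Fq =
        ∑ p ∈ Finset.HasAntidiagonal.antidiagonal k,
          invD Fq p.1 ^ Fintype.card Fq • g p.2 ^ Fintype.card Fq ^ (p.1 + 1) := by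
      have := map_sum (FiniteField.frobeniusAlgHom Fq (MvPolynomial σ (RatFunc Fq)))
        (fun p : ℕ × ℕ => invD Fq p.1 • g p.2 ^ Fintype.card Fq ^ p.1) (Finset.HasAntidiagonal.antidiagonal k)
      simp only [FiniteField.frobeniusAlgHom_apply] at this
      rw [this]
      refine Finset.sum_congr rfl fun p _ => ?_
      rw [_root_.smul_pow, ← pow_mul, pow_succ]
    rw [hs, add_assoc, ← Finset.sum_add_distrib]
    congr 1
    · simp [hsm, hsm']
    · refine Finset.sum_congr rfl fun p _ => ?_
      rw [hsm, hsm', invD_succ, add_smul]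

theorem expSeq_smul (a : Fq[X]) (g : ℕ → MvPolynomial σ (RatFunc Fq)) :
    expSeq Fq σ (a • g) =
      aeval (thetaAddTau (seqTau Fq (MvPolynomial σ (RatFunc Fq)))) a (expSeq Fq σ g) := by
  induction a using Polynomial.induction_on' with
  | add p q hp hq => rw [add_smul, map_add, hp, hq, map_add, LinearMap.add_apply]
  | monomial n r =>
    induction n with
    | zero => rw [monomial_zero_left, C_smul_eq, map_smul, aeval_C, Module.algebraMap_end_apply]
    | succ n ih =>
      rw [← X_mul_monomial, mul_smul, expSeq_X_smul, ih, map_mul, aeval_X, Module.End.mul_apply]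

/-- The shift `∑ g_k Z ^ (q ^ k) ↦ ∑ φ(g_k) Z ^ (q ^ (k + d))`. -/
def shiftMap {R : Type*} [Zero R] (φ : R → R) (d : ℕ) (g : ℕ → R) (k : ℕ) : R :=
  if d ≤ k then φ (g (k - d)) else 0

/-- The shift comes from a `K`-algebra endomorphism of power series, `φ` on coefficients and `Z ↦ Z
^ (q ^ d)`, so it respects `q`-th powers and division by `D_i`. It is used for `φ` the substitution
by `C_P`, where it is the operation `P *`. -/
theorem expSeq_shiftMap (φ : MvPolynomial σ (RatFunc Fq) →ₐ[RatFunc Fq] MvPolynomial σ (RatFunc Fq))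
    (d : ℕ) (g : ℕ → MvPolynomial σ (RatFunc Fq)) :
    expSeq Fq σ (shiftMap φ d g) = shiftMap φ d (expSeq Fq σ g) := by
  induction d with
  | zero =>
    ext1 k
    simp [shiftMap, expSeq_apply]
  | succ d ih =>
    ext1 k
    cases k with
    | zero => simp [shiftMap, expSeq_apply]
    | succ k =>
      have h := congrFun ih k
      rw [expSeq_apply] at h ⊢
      rw [Finset.Nat.sum_antidiagonal_succ']
      simpa [shiftMap] using h

end Exponential

/-! ### Polynomials integral at a prime of `A`. -/

section Localization

variable {Fq : Type*} [Field Fq] {σ : Type*}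

/-- The localization of `A` at a prime ideal, inside `K`. -/
noncomputable def localRing (𝔭 : Ideal Fq[X]) [𝔭.IsPrime] : Subalgebra Fq[X] (RatFunc Fq) :=
  Localization.subalgebra.ofField (RatFunc Fq) 𝔭.primeCompl 𝔭.primeCompl_le_nonZeroDivisors

instance (𝔭 : Ideal Fq[X]) [𝔭.IsPrime] : IsLocalization 𝔭.primeCompl (localRing 𝔭) :=
  Localization.subalgebra.isLocalization_ofField _ _ _

theorem inv_mem_localRing {𝔭 : Ideal Fq[X]} [𝔭.IsPrime] {a : Fq[X]} (ha : a ∉ 𝔭) :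
    (algebraMap Fq[X] (RatFunc Fq) a)⁻¹ ∈ localRing 𝔭 :=
  ⟨1, a, ha, by simp⟩

/-- The polynomials with coefficients in `O`. -/
noncomputable def integralPolys (σ : Type*) (O : Subalgebra Fq[X] (RatFunc Fq)) :
    Subalgebra Fq[X] (MvPolynomial σ (RatFunc Fq)) :=
  (MvPolynomial.mapAlgHom (σ := σ) O.val).range

theorem smul_mem_integralPolys {O : Subalgebra Fq[X] (RatFunc Fq)} {c : RatFunc Fq} (hc : c ∈ O)
    {x : MvPolynomial σ (RatFunc Fq)} (hx : x ∈ integralPolys σ O) : c • x ∈ integralPolys σ O := by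
  rw [MvPolynomial.smul_eq_C_mul]
  refine mul_mem ⟨MvPolynomial.C ⟨c, hc⟩, ?_⟩ hx
  simp

theorem map_mem_integralPolys (O : Subalgebra Fq[X] (RatFunc Fq)) (F : MvPolynomial σ Fq[X]) :
    MvPolynomial.map (algebraMap Fq[X] (RatFunc Fq)) F ∈ integralPolys σ O := by
  refine ⟨MvPolynomial.map (algebraMap Fq[X] O) F, ?_⟩
  change MvPolynomial.map _ (MvPolynomial.map _ F) = _
  rw [MvPolynomial.map_map]
  rfl

/-- `P O[X]`. -/
noncomputable def primeMultiples (σ : Type*) (P : Fq[X]) (𝔭 : Ideal Fq[X]) [𝔭.IsPrime] :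
    Submodule Fq[X] (MvPolynomial σ (RatFunc Fq)) :=
  P • Subalgebra.toSubmodule (integralPolys σ (localRing 𝔭))

theorem mem_primeMultiples {P : Fq[X]} {𝔭 : Ideal Fq[X]} [𝔭.IsPrime]
    {x : MvPolynomial σ (RatFunc Fq)} :
    x ∈ primeMultiples σ P 𝔭 ↔ ∃ y ∈ integralPolys σ (localRing 𝔭), P • y = x :=
  Submodule.mem_smul_pointwise_iff_exists _ _ _

end Localization

/-! ### Integrality of the coefficients, prime by prime. -/

variable {Fq : Type*} [Field Fq] [Fintype Fq] {σ : Type*}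

theorem finite_monic_natDegree_eq (j : ℕ) :
    {a : Fq[X] | a.Monic ∧ a.natDegree = j}.Finite := by
  have : Finite (Polynomial.degreeLT Fq (j + 1)) :=
    Finite.of_equiv _ (Polynomial.degreeLTEquiv Fq (j + 1)).symm.toEquiv
  refine (Set.toFinite (Polynomial.degreeLT Fq (j + 1) : Set Fq[X])).subset ?_
  rintro a ⟨ha, hj⟩
  rw [SetLike.mem_coe, mem_degreeLT, degree_eq_natDegree ha.ne_zero, hj]
  exact_mod_cast j.lt_succ_self

/-- The monic polynomials of degree `j`. -/
noncomputable def monics (Fq : Type*) [Field Fq] [Fintype Fq] (j : ℕ) : Finset Fq[X] :=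
  (finite_monic_natDegree_eq j).toFinset

@[simp] theorem mem_monics {j : ℕ} {a : Fq[X]} :
    a ∈ monics Fq j ↔ a.Monic ∧ a.natDegree = j := by
  simp [monics]

/-- `∑ F(C_a(X)) / a`, over the monic `a` of degree `j`. -/
noncomputable def starSum (F : MvPolynomial σ (RatFunc Fq)) (j : ℕ) : MvPolynomial σ (RatFunc Fq) :=
  ∑ a ∈ monics Fq j, (algebraMap Fq[X] (RatFunc Fq) a)⁻¹ • carlitzSubst (RatFunc Fq) a F

-- The multiples of `P` among the monic `a` of degree `j` are the `P b` with `b` monic of degree `j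
-- - deg P`; after multiplication by `P` their terms are the images under `X_i ↦ C_P(X_i)` of the
-- terms of `b`. The remaining `a` have denominators prime to `P`.
open Classical in
theorem smul_starSum {P : Fq[X]} (hm : P.Monic)
    (F : MvPolynomial σ (RatFunc Fq)) (j : ℕ) :
    P • starSum F j = shiftMap (carlitzSubst (RatFunc Fq) P) P.natDegree (starSum F) j +
      P • ∑ a ∈ monics Fq j with ¬ P ∣ a,
        (algebraMap Fq[X] (RatFunc Fq) a)⁻¹ • carlitzSubst (RatFunc Fq) a F := by
  rw [starSum, ← Finset.sum_filter_add_sum_filter_not _ (P ∣ ·), smul_add]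
  congr 1
  rw [shiftMap]
  have hP0 : algebraMap Fq[X] (RatFunc Fq) P ≠ 0 := by
    rw [ne_eq, FaithfulSMul.algebraMap_eq_zero_iff]
    exact hm.ne_zero
  split_ifs with h
  · rw [starSum, map_sum, Finset.smul_sum]
    symm
    refine Finset.sum_nbij (P * ·) ?_ ?_ ?_ ?_
    · intro b hb
      rw [mem_monics] at hb
      simp [hm.mul hb.1, hm.natDegree_mul hb.1, hb.2, h]
    · intro b _ c _ hbc
      exact mul_left_cancel₀ hm.ne_zero hbc
    · intro a ha
      simp only [Finset.coe_filter, mem_monics, Set.mem_ofPred_eq] at ha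
      obtain ⟨⟨ha, hj⟩, b, rfl⟩ := ha
      have hb := hm.of_mul_monic_left ha
      rw [hm.natDegree_mul hb] at hj
      refine ⟨b, ?_, rfl⟩
      simp only [Finset.mem_coe, mem_monics]
      exact ⟨hb, by omega⟩
    · intro b _
      rw [map_smul, carlitzSubst_mul, ← algebraMap_smul (RatFunc Fq) P, ← mul_smul, map_mul, mul_inv,
        mul_inv_cancel_left₀ hP0]
  · rw [Finset.sum_eq_zero, smul_zero]
    intro a ha
    rw [Finset.mem_filter, mem_monics] at ha
    have := natDegree_le_of_dvd ha.2 ha.1.1.ne_zero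
    omega

theorem carlitzSubst_mem_integralPolys {O : Subalgebra Fq[X] (RatFunc Fq)} (a : Fq[X])
    {x : MvPolynomial σ (RatFunc Fq)} (hx : x ∈ integralPolys σ O) :
    carlitzSubst (RatFunc Fq) a x ∈ integralPolys σ O := by
  obtain ⟨y, rfl⟩ := hx
  exact ⟨carlitzSubst O a y, mapAlgHom_carlitzSubst O.val a y⟩

section Local

variable {P : Fq[X]} {𝔭 : Ideal Fq[X]} [𝔭.IsPrime]

theorem carlitzSubst_sub_pow_mem (hP : Irreducible P) (hm : P.Monic)
    {x : MvPolynomial σ (RatFunc Fq)} (hx : x ∈ integralPolys σ (localRing 𝔭)) :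
    carlitzSubst (RatFunc Fq) P x - x ^ Fintype.card Fq ^ P.natDegree ∈
      primeMultiples σ P 𝔭 := by
  obtain ⟨x, rfl⟩ := hx
  obtain ⟨y, hy⟩ := exists_carlitzSubst_eq_pow_add hP hm 𝔭.primeCompl x
  refine mem_primeMultiples.2 ⟨_, ⟨y, rfl⟩, ?_⟩
  have h := mapAlgHom_carlitzSubst (localRing 𝔭).val P x
  rw [hy, map_add, map_smul, map_pow] at h
  exact eq_sub_of_add_eq' h

/-- The `P`-valuation of `D_i` is at most `q ^ i - 1`: as `X ^ (q ^ (i + 1)) - X` is squarefree,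
each recursion step takes a bound `v` to `1 + q v`, and `1 + q (q ^ i - 1) ≤ q ^ (i + 1) - 1`. The
factor `b` absorbs the part prime to `P`. -/
theorem exists_carlitzD_dvd (hP : Irreducible P) (i : ℕ) :
    ∃ b, ¬ P ∣ b ∧ carlitzD Fq i ∣ b * P ^ (Fintype.card Fq ^ i - 1) := by
  induction i with
  | zero => exact ⟨1, hP.prime.not_dvd_one, one_dvd _⟩
  | succ i ih =>
    obtain ⟨b, hb, hD⟩ := ih
    obtain ⟨b', hb', hX⟩ : ∃ b', ¬ P ∣ b' ∧ (X ^ Fintype.card Fq ^ (i + 1) - X : Fq[X]) ∣ b' * P := by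
      by_cases h : P ∣ (X ^ Fintype.card Fq ^ (i + 1) - X : Fq[X])
      · obtain ⟨b', hb'⟩ := h
        refine ⟨b', ?_, by rw [hb', mul_comm]⟩
        rintro ⟨c, rfl⟩
        obtain ⟨p, hp⟩ := CharP.exists Fq
        have hs := (galois_poly_separable p (Fintype.card Fq ^ (i + 1))
          (dvd_pow ((CharP.cast_eq_zero_iff Fq p _).1 (FiniteField.cast_card_eq_zero Fq))
            i.succ_ne_zero) : (X ^ Fintype.card Fq ^ (i + 1) - X : Fq[X]).Separable).squarefree
        exact hP.not_isUnit (hs P (by rw [hb', ← mul_assoc]; exact dvd_mul_right _ _))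
      · exact ⟨_, h, dvd_mul_right _ _⟩
    refine ⟨b' * b ^ Fintype.card Fq, ?_, ?_⟩
    · exact hP.prime.not_dvd_mul hb' fun h => hb (hP.prime.dvd_of_dvd_pow h)
    · rw [carlitzD_succ]
      refine (mul_dvd_mul hX (pow_dvd_pow_of_dvd hD _)).trans ?_
      have hq : 1 < Fintype.card Fq := Fintype.one_lt_card
      have hqi : 0 < Fintype.card Fq ^ i := pow_pos (by omega) _
      have he : 1 + (Fintype.card Fq ^ i - 1) * Fintype.card Fq ≤ Fintype.card Fq ^ (i + 1) - 1 := by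
        rw [Nat.sub_mul, ← pow_succ, one_mul]
        have : Fintype.card Fq ≤ Fintype.card Fq ^ (i + 1) := by
          rw [pow_succ]
          exact Nat.le_mul_of_pos_left _ hqi
        omega
      rw [mul_pow, ← pow_mul, mul_mul_mul_comm, ← pow_succ']
      exact mul_dvd_mul_left _ (pow_dvd_pow _ (by omega))

theorem pow_mul_invD_mem (hP : Irreducible P) (h𝔭 : 𝔭 = Ideal.span {P}) (i : ℕ) :
    algebraMap Fq[X] (RatFunc Fq) (P ^ (Fintype.card Fq ^ i - 1)) * invD Fq i ∈ localRing 𝔭 := by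
  obtain ⟨b, hb, c, hc⟩ := exists_carlitzD_dvd hP i
  have hb' : b ∉ 𝔭 := by rwa [h𝔭, Ideal.mem_span_singleton]
  have hb0 : algebraMap Fq[X] (RatFunc Fq) b ≠ 0 := by
    rw [ne_eq, FaithfulSMul.algebraMap_eq_zero_iff]
    rintro rfl
    exact hb (dvd_zero _)
  have hD : algebraMap Fq[X] (RatFunc Fq) (carlitzD Fq i) ≠ 0 := by
    rw [ne_eq, FaithfulSMul.algebraMap_eq_zero_iff]
    exact carlitzD_ne_zero i
  have h : algebraMap Fq[X] (RatFunc Fq) (P ^ (Fintype.card Fq ^ i - 1)) * invD Fq i =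
      (algebraMap Fq[X] (RatFunc Fq) b)⁻¹ * algebraMap Fq[X] (RatFunc Fq) c := by
    rw [invD, ← div_eq_mul_inv, div_eq_iff hD, mul_assoc, ← map_mul, mul_comm c, ← hc, map_mul,
      inv_mul_cancel_left₀ hb0]
  rw [h]
  exact mul_mem (inv_mem_localRing hb') (Subalgebra.algebraMap_mem _ _)

/-- In `(P u) ^ (q ^ i) / D_i` the factor `P ^ (q ^ i - 1)` cancels the denominator at `P`, and one
factor `P` is left over. -/
theorem expSeq_smul_mem (hP : Irreducible P) (h𝔭 : 𝔭 = Ideal.span {P})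
    {u : ℕ → MvPolynomial σ (RatFunc Fq)} (hu : ∀ k, u k ∈ integralPolys σ (localRing 𝔭)) (k : ℕ) :
    expSeq Fq σ (P • u) k ∈ primeMultiples σ P 𝔭 := by
  rw [expSeq_apply]
  refine Submodule.sum_mem _ fun p _ => mem_primeMultiples.2
    ⟨_, smul_mem_integralPolys (pow_mul_invD_mem hP h𝔭 p.1)
      (pow_mem (hu p.2) (Fintype.card Fq ^ p.1)), ?_⟩
  have hq : Fintype.card Fq ^ p.1 ≠ 0 := pow_ne_zero _ Fintype.card_ne_zero
  rw [mul_smul, algebraMap_smul, ← mul_smul, mul_pow_sub_one hq, Pi.smul_apply, _root_.smul_pow,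
    smul_comm]

/-- Dwork's argument: `exp_C` of `∑ a * F / a` is integral at `P`, as `X_j ↦ C_P(X_j)` lifts Frobenius. -/
theorem expSeq_starSum_mem (hP : Irreducible P) (hm : P.Monic) (h𝔭 : 𝔭 = Ideal.span {P})
    {F : MvPolynomial σ (RatFunc Fq)} (hF : F ∈ integralPolys σ (localRing 𝔭)) (k : ℕ) :
    expSeq Fq σ (starSum F) k ∈ integralPolys σ (localRing 𝔭) := by
  classical
  let u : ℕ → MvPolynomial σ (RatFunc Fq) := fun j => ∑ a ∈ monics Fq j with ¬ P ∣ a,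
    (algebraMap Fq[X] (RatFunc Fq) a)⁻¹ • carlitzSubst (RatFunc Fq) a F
  have hu : ∀ j, u j ∈ integralPolys σ (localRing 𝔭) := fun j => sum_mem fun a ha =>
    smul_mem_integralPolys (inv_mem_localRing (by
      rw [h𝔭, Ideal.mem_span_singleton]
      exact (Finset.mem_filter.1 ha).2)) (carlitzSubst_mem_integralPolys a hF)
  set φ := carlitzSubst (σ := σ) (RatFunc Fq) P
  set d := P.natDegree with hd
  have hd0 : 0 < d := hP.natDegree_pos
  set f := expSeq Fq σ (starSum F) with hf
  have hS : P • starSum F = shiftMap φ d (starSum F) + P • u := funext (smul_starSum hm F)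
  -- The difference is `exp_C(P u)`, by the functional equation applied to `hS`.
  have key : ∀ k, aeval (thetaAddTau (seqTau Fq (MvPolynomial σ (RatFunc Fq)))) P f k -
      shiftMap φ d f k ∈ primeMultiples σ P 𝔭 := by
    intro k
    rw [hf, ← expSeq_smul, hS, map_add, expSeq_shiftMap, Pi.add_apply, add_sub_cancel_left]
    exact expSeq_smul_mem hP h𝔭 hu k
  induction k using Nat.strong_induction_on with
  | _ k ih =>
    have h := key k
    -- The sum `C_P(f)_k` is split into `P f_k`, the terms with `0 < i < d`, divisible by `P`
    -- through their coefficients (`h1`), and the `τ ^ d` term, which cancels the shift modulo `P`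
    -- (`h2`). What remains is that `P f_k` is `P` times an integral polynomial.
    rw [aeval_thetaAddTau_apply _ seqTau_smul le_rfl, Finset.sum_apply, Finset.sum_range_succ,
      ← hd, (carlitzCoeff_of_natDegree_le le_rfl).1, hm.coeff_natDegree, C_1, one_smul,
      ← Nat.succ_pred_eq_of_pos hd0, Finset.sum_range_succ', Nat.succ_pred_eq_of_pos hd0,
      carlitzCoeff_zero, add_assoc, add_sub_assoc] at h
    have h1 : ∑ i ∈ Finset.range d.pred, (carlitzCoeff P (i + 1) •
        (seqTau Fq (MvPolynomial σ (RatFunc Fq)) ^ (i + 1)) f) k ∈ primeMultiples σ P 𝔭 := by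
      refine Submodule.sum_mem _ fun i hi => ?_
      obtain ⟨c, hc⟩ := dvd_carlitzCoeff hP (i := i + 1) (by
        have := Finset.mem_range.1 hi; rw [Nat.pred_eq_sub_one] at this; omega)
      rw [hc, Pi.smul_apply, mul_smul, seqTau_pow_apply]
      refine mem_primeMultiples.2 ⟨_, Subalgebra.smul_mem _ ?_ c, rfl⟩
      split_ifs
      · exact pow_mem (ih _ (by omega)) _
      · exact zero_mem _
    have h2 : (seqTau Fq (MvPolynomial σ (RatFunc Fq)) ^ d) f k - shiftMap φ d f k ∈
        primeMultiples σ P 𝔭 := by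
      rw [seqTau_pow_apply, shiftMap]
      split_ifs
      · rw [← neg_sub]
        exact neg_mem (carlitzSubst_sub_pow_mem hP hm (ih _ (by omega)))
      · simp
    rw [Submodule.add_mem_iff_right _ h1, add_sub_assoc, Submodule.add_mem_iff_left _ h2] at h
    obtain ⟨y, hy, hyk⟩ := mem_primeMultiples.1 h
    have hPy : P • y = P • f k := by simpa using hyk
    have hP0 : algebraMap Fq[X] (RatFunc Fq) P ≠ 0 := by
      rw [ne_eq, FaithfulSMul.algebraMap_eq_zero_iff]
      exact hm.ne_zero
    rw [← algebraMap_smul (RatFunc Fq) P, ← algebraMap_smul (RatFunc Fq) P] at hPy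
    rwa [← smul_right_injective _ hP0 hPy]

end Local

/-- `A` is the intersection in `K` of its localizations at maximal ideals, each of which is
generated by a monic irreducible. -/
theorem expSeq_starSum_integral (F : MvPolynomial σ Fq[X]) (k : ℕ) :
    ∃ G : MvPolynomial σ Fq[X],
      expSeq Fq σ (starSum (MvPolynomial.map (algebraMap Fq[X] (RatFunc Fq)) F)) k =
        MvPolynomial.map (algebraMap Fq[X] (RatFunc Fq)) G := by
  suffices h : expSeq Fq σ (starSum (MvPolynomial.map (algebraMap Fq[X] (RatFunc Fq)) F)) k ∈
      Set.range (MvPolynomial.map (σ := σ) (algebraMap Fq[X] (RatFunc Fq))) by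
    obtain ⟨G, hG⟩ := h
    exact ⟨G, hG.symm⟩
  rw [MvPolynomial.mem_range_map_iff_coeffs_subset]
  intro c hc
  rw [Finset.mem_coe, MvPolynomial.mem_coeffs_iff] at hc
  obtain ⟨m, -, rfl⟩ := hc
  suffices h : MvPolynomial.coeff m
      (expSeq Fq σ (starSum (MvPolynomial.map (algebraMap Fq[X] (RatFunc Fq)) F)) k) ∈
      (⨅ v : MaximalSpectrum Fq[X], Localization.subalgebra.ofField (RatFunc Fq) _
        v.asIdeal.primeCompl_le_nonZeroDivisors) by
    rw [MaximalSpectrum.iInf_localization_eq_bot] at h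
    obtain ⟨a, ha⟩ := Algebra.mem_bot.1 h
    exact ⟨a, ha⟩
  rw [Algebra.mem_iInf]
  intro v
  obtain ⟨P, hP, hm, hv⟩ : ∃ P : Fq[X], Irreducible P ∧ P.Monic ∧ v.asIdeal = Ideal.span {P} := by
    have hne : v.asIdeal ≠ ⊥ :=
      Ring.ne_bot_of_isMaximal_of_not_isField v.isMaximal (Polynomial.not_isField Fq)
    have hg := (Submodule.IsPrincipal.prime_generator_of_isPrime v.asIdeal hne).irreducible
    classical
    exact ⟨normalize (Submodule.IsPrincipal.generator v.asIdeal),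
      (normalize_associated _).symm.irreducible hg, monic_normalize hg.ne_zero, by
        rw [Ideal.span_singleton_eq_span_singleton.2 (normalize_associated _),
          Ideal.span_singleton_generator]⟩
  obtain ⟨y, hy⟩ := expSeq_starSum_mem hP hm hv (map_mem_integralPolys _ F) k
  rw [← hy]
  change MvPolynomial.coeff m (MvPolynomial.map _ y) ∈ _
  rw [MvPolynomial.coeff_map]
  exact (MvPolynomial.coeff m y).2

/-! ### The coefficients of 𝔏(F, Z) as power series in `Z`. -/

variable {Fq : Type*} [Field Fq] [Fintype Fq]

/-- In characteristic `p`, raising a series to the power `q ^ i` is Frobenius on the coefficients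
together with `Z ↦ Z ^ (q ^ i)`. -/
theorem coeff_pow_card_pow {R : Type*} [CommRing R] [Nontrivial R] [Algebra Fq R] (i n : ℕ)
    (G : PowerSeries R) :
    PowerSeries.coeff n (G ^ Fintype.card Fq ^ i) = if Fintype.card Fq ^ i ∣ n then
      (PowerSeries.coeff (n / Fintype.card Fq ^ i) G) ^ Fintype.card Fq ^ i else 0 := by
  obtain ⟨p, hp⟩ := CharP.exists Fq
  obtain ⟨e, hprime, hq⟩ := FiniteField.card Fq p
  have : Fact p.Prime := ⟨hprime⟩
  have : CharP R p := charP_of_injective_algebraMap (algebraMap Fq R).injective p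
  have hexp : ExpChar R p := ExpChar.prime hprime
  have h : PowerSeries.map (iterateFrobenius R p (e * i))
      (PowerSeries.expand (p ^ ((e : ℕ) * i)) (pow_ne_zero _ hprime.ne_zero) G) =
      G ^ p ^ ((e : ℕ) * i) :=
    MvPowerSeries.map_iterateFrobenius_expand p hprime.ne_zero G (e * i)
  rw [hq, ← pow_mul, ← h, PowerSeries.coeff_map, PowerSeries.coeff_expand]
  split_ifs
  · rw [iterateFrobenius_def]
  · simp

variable {s : ℕ}

theorem coeff_lTerm (F : MvPolynomial (Fin s) (RatFunc Fq)) (a : {a : Fq[X] // a.Monic}) (n : ℕ) :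
    PowerSeries.coeff n (lTerm F a) = if n = Fintype.card Fq ^ a.1.natDegree then
      (algebraMap Fq[X] (RatFunc Fq) a.1)⁻¹ • carlitzSubst (RatFunc Fq) a.1 F else 0 := by
  rw [lTerm, star_C_mul_X, PowerSeries.coeff_smul, PowerSeries.coeff_C_mul,
    PowerSeries.coeff_X_pow]
  split_ifs
  · rw [mul_one]; rfl
  · rw [mul_zero, smul_zero]

theorem coeff_lSeries_of_ne (F : MvPolynomial (Fin s) (RatFunc Fq)) {n : ℕ}
    (hn : ∀ j, n ≠ Fintype.card Fq ^ j) : PowerSeries.coeff n (lSeries F) = 0 := by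
  rw [lSeries, formalSum, PowerSeries.coeff_mk]
  exact finsum_eq_zero_of_forall_eq_zero fun a => by rw [coeff_lTerm, if_neg (hn _)]

theorem coeff_lSeries (F : MvPolynomial (Fin s) (RatFunc Fq)) (j : ℕ) :
    PowerSeries.coeff (Fintype.card Fq ^ j) (lSeries F) = starSum F j := by
  classical
  have hinj := Nat.pow_right_injective (Fintype.one_lt_card (α := Fq))
  rw [lSeries, formalSum, PowerSeries.coeff_mk,
    finsum_eq_sum_of_support_subset (s := (monics Fq j).subtype Monic)]
  · rw [starSum, ← Finset.sum_subtype_of_mem (p := Monic) _ fun a ha => (mem_monics.1 ha).1]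
    refine Finset.sum_congr rfl fun a ha => ?_
    rw [Finset.mem_subtype, mem_monics] at ha
    rw [coeff_lTerm, ha.2, if_pos rfl]
  · intro a ha
    rw [Function.mem_support, coeff_lTerm] at ha
    simp only [ne_eq, ite_eq_right_iff, Classical.not_imp] at ha
    rw [Finset.mem_coe, Finset.mem_subtype, mem_monics]
    exact ⟨a.2, (hinj ha.1).symm⟩

theorem coeff_expTerm (G : PowerSeries (MvPolynomial (Fin s) (RatFunc Fq))) (i n : ℕ) :
    PowerSeries.coeff n (expTerm G i) = if Fintype.card Fq ^ i ∣ n then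
      invD Fq i • (PowerSeries.coeff (n / Fintype.card Fq ^ i) G) ^ Fintype.card Fq ^ i else 0 := by
  rw [expTerm, PowerSeries.coeff_smul, coeff_pow_card_pow]
  split_ifs
  · rfl
  · rw [smul_zero]

theorem coeff_logAlg_of_ne (F : MvPolynomial (Fin s) (RatFunc Fq)) {n : ℕ}
    (hn : ∀ j, n ≠ Fintype.card Fq ^ j) : PowerSeries.coeff n (logAlg F) = 0 := by
  rw [logAlg, expC, formalSum, PowerSeries.coeff_mk]
  refine finsum_eq_zero_of_forall_eq_zero fun i => ?_
  rw [coeff_expTerm]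
  split_ifs with h
  · obtain ⟨m, rfl⟩ := h
    have hq : 0 < Fintype.card Fq ^ i := pow_pos Fintype.card_pos _
    rw [Nat.mul_div_cancel_left _ hq, coeff_lSeries_of_ne, zero_pow hq.ne', smul_zero]
    rintro j rfl
    exact hn (i + j) (pow_add _ _ _).symm
  · rfl

theorem coeff_logAlg (F : MvPolynomial (Fin s) (RatFunc Fq)) (k : ℕ) :
    PowerSeries.coeff (Fintype.card Fq ^ k) (logAlg F) = expSeq Fq (Fin s) (starSum F) k := by
  rw [logAlg, expC, formalSum, PowerSeries.coeff_mk,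
    finsum_eq_sum_of_support_subset (s := Finset.range (k + 1)), expSeq_apply,
    Finset.Nat.sum_antidiagonal_eq_sum_range_succ_mk]
  · refine Finset.sum_congr rfl fun i hi => ?_
    have hik : i ≤ k := Nat.lt_succ_iff.1 (Finset.mem_range.1 hi)
    rw [coeff_expTerm, if_pos (pow_dvd_pow _ hik), Nat.pow_div hik Fintype.card_pos, coeff_lSeries]
  · intro i hi
    rw [Function.mem_support, coeff_expTerm] at hi
    simp only [ne_eq, ite_eq_right_iff, Classical.not_imp] at hi
    have := (Nat.pow_dvd_pow_iff_le_right (Fintype.one_lt_card (α := Fq))).1 hi.1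
    exact Finset.mem_coe.2 (Finset.mem_range.2 (Nat.lt_succ_iff.2 this))

/-! ### Valuations and places. -/

theorem valuation_isTrivialOn {Fq : Type*} [Field Fq] [Fintype Fq] {E : Type*} [Field E]
    [Algebra Fq E] {Γ : Type*} [LinearOrderedCommGroupWithZero Γ] (v : Valuation E Γ) :
    v.IsTrivialOn Fq where
  eq_one a ha := by
    have h : v (algebraMap Fq E a) ^ (Fintype.card Fq - 1) = 1 := by
      rw [← map_pow, ← map_pow, FiniteField.pow_card_sub_one_eq_one a ha, map_one, map_one]
    have hq : 1 < Fintype.card Fq := Fintype.one_lt_card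
    exact (pow_eq_one_iff.1 h).resolve_right (by omega)

section Places

variable {Fq : Type*} [Field Fq] {E : Type*} [Field E] [Algebra Fq E] [Algebra Fq[X] E]

/-- An element which is small at all places over `∞`, and integral at all other places, is `0`. -/
theorem eq_zero_of_valuation_lt_one [IsScalarTower Fq Fq[X] E]
    (hinj : Function.Injective (algebraMap Fq[X] E)) {y : E}
    (h1 : ∀ V : ValuationSubring E, 1 < V.valuation (algebraMap Fq[X] E X) → V.valuation y < 1)
    (h2 : ∀ V : ValuationSubring E, V.valuation (algebraMap Fq[X] E X) ≤ 1 → V.valuation y ≤ 1) :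
    y = 0 := by
  by_contra hy
  -- The valuation rings containing `R` intersect in `R`, which replaces the product formula. As `θ`
  -- is not in `R`, some place over `∞` exists; `y` is small there, so `y` is not in `R`, whose
  -- nonzero elements are units. Hence `y` has a pole at some place `W`, against both hypotheses.
  let R : Subring E := (integralClosure Fq E).toSubring
  have hR : IsIntegrallyClosedIn R E :=
    inferInstanceAs (IsIntegrallyClosedIn (integralClosure Fq E) E)
  have hθ : algebraMap Fq[X] E X ∉ R := by
    rintro ⟨p, hp, h⟩
    rw [← aeval_def, aeval_algebraMap_apply, aeval_X_left_apply] at h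
    exact hp.ne_zero ((map_eq_zero_iff _ hinj).1 h)
  obtain ⟨V, hV, hθV⟩ := R.exists_le_valuationSubring_of_isIntegrallyClosedIn hθ
  rw [← V.valuation_le_one_iff, not_le] at hθV
  have hyV := h1 V hθV
  have hyR : y ∉ R := by
    intro h
    have h' : y⁻¹ ∈ R := IsIntegral.inv h
    have h3 := (V.valuation_le_one_iff _).2 (hV h')
    rw [map_inv₀] at h3
    have h0 : 0 < V.valuation y := by simpa [zero_lt_iff] using hy
    exact absurd ((inv_le_one₀ h0).1 h3) (not_le.2 hyV)
  obtain ⟨W, -, hW⟩ := R.exists_le_valuationSubring_of_isIntegrallyClosedIn hyR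
  rw [← W.valuation_le_one_iff, not_le] at hW
  rcases le_or_gt (W.valuation (algebraMap Fq[X] E X)) 1 with h | h
  · exact absurd (h2 W h) (not_le.2 hW)
  · exact lt_asymm (h1 W h) hW

end Places

/-! ### Torsion points of the Carlitz module and their size. -/

section Torsion

variable {Fq : Type*} [Field Fq] [Fintype Fq]

theorem carlitz_X_apply {R : Type*} [CommRing R] [Algebra Fq R] [Algebra Fq[X] R] (x : R) :
    carlitz Fq R X x = algebraMap Fq[X] R X * x + x ^ Fintype.card Fq := by
  simp [carlitz]

variable {E : Type*} [Field E] [Algebra Fq E] [Algebra Fq[X] E]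

/-- The `θ`-power torsion points of the Carlitz module. -/
def torsion (Fq : Type*) [Field Fq] [Fintype Fq] (E : Type*) [Field E] [Algebra Fq E]
    [Algebra Fq[X] E] : Set E :=
  {x | ∃ n : ℕ, carlitz Fq E (X ^ n) x = 0}

theorem carlitz_mem_torsion (a : Fq[X]) {x : E} (hx : x ∈ torsion Fq E) :
    carlitz Fq E a x ∈ torsion Fq E := by
  obtain ⟨n, hn⟩ := hx
  exact ⟨n, by rw [← Module.End.mul_apply, ← map_mul, mul_comm, map_mul, Module.End.mul_apply, hn,
    map_zero]⟩

/-- On the torsion points `C_θ` is surjective, since `E` is algebraically closed, but not injective,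
since a root of `z ^ (q - 1) = -θ` is a nonzero element of the kernel. A finite set admits no such
self-map. -/
theorem torsion_infinite [IsAlgClosed E] (hθ : algebraMap Fq[X] E X ≠ 0) :
    (torsion Fq E).Infinite := by
  intro hfin
  have hfin' : Finite (torsion Fq E) := hfin
  have hq : 1 < Fintype.card Fq := Fintype.one_lt_card
  let f : torsion Fq E → torsion Fq E := fun x => ⟨_, carlitz_mem_torsion X x.2⟩
  have hsurj : Function.Surjective f := by
    rintro ⟨y, n, hn⟩
    obtain ⟨x, hx⟩ : ∃ x : E, carlitz Fq E X x = y := by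
      have hdeg : (C (algebraMap Fq[X] E X) * X - C y : E[X]).degree <
          (Fintype.card Fq : WithBot ℕ) := by
        refine lt_of_le_of_lt (b := 1) (by compute_degree) ?_
        exact_mod_cast hq
      obtain ⟨x, hx⟩ := IsAlgClosed.exists_root
        (X ^ Fintype.card Fq + (C (algebraMap Fq[X] E X) * X - C y) : E[X]) (by
          rw [degree_add_eq_left_of_degree_lt (by rwa [degree_X_pow]), degree_X_pow]
          exact_mod_cast Fintype.card_ne_zero)
      refine ⟨x, ?_⟩
      rw [carlitz_X_apply]
      simp only [IsRoot.def, eval_add, eval_pow, eval_X, eval_sub, eval_mul, eval_C] at hx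
      linear_combination hx
    refine ⟨⟨x, n + 1, ?_⟩, Subtype.ext hx⟩
    rw [pow_succ, map_mul, Module.End.mul_apply, hx, hn]
  have hinj := Finite.injective_iff_surjective.2 hsurj
  obtain ⟨z, hz⟩ := IsAlgClosed.exists_pow_nat_eq (-algebraMap Fq[X] E X)
    (n := Fintype.card Fq - 1) (by omega)
  have hz0 : carlitz Fq E X z = 0 := by
    rw [carlitz_X_apply, ← pow_sub_one_mul Fintype.card_ne_zero, hz]
    ring
  have h := @hinj ⟨z, 1, by rwa [pow_one]⟩ ⟨0, 0, map_zero _⟩ (Subtype.ext (by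
    change carlitz Fq E X z = carlitz Fq E X 0
    rw [hz0, map_zero]))
  replace h : z = 0 := congrArg Subtype.val h
  rw [h, zero_pow (by omega), eq_comm, neg_eq_zero] at hz
  exact hθ hz

section Valuation

variable {Γ : Type*} [LinearOrderedCommGroupWithZero Γ] (v : Valuation E Γ)

/-- `max (1, |θ|)`. -/
noncomputable def thetaBound (Fq : Type*) [Field Fq] {E : Type*} [Field E] [Algebra Fq[X] E]
    {Γ : Type*} [LinearOrderedCommGroupWithZero Γ] (v : Valuation E Γ) : Γ :=
  max 1 (v (algebraMap Fq[X] E X))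

/-- Above the bound `x ^ q` dominates `θ x`, so `C_θ(x)` has value `|x| ^ q` and is again above the
bound; iterating `C_θ` never reaches 0. -/
theorem valuation_le_of_mem_torsion {x : E} (hx : x ∈ torsion Fq E) :
    v x ≤ thetaBound Fq v := by
  obtain ⟨n, hn⟩ := hx
  have hq : 1 < Fintype.card Fq := Fintype.one_lt_card
  by_contra! h
  induction n generalizing x with
  | zero =>
    rw [pow_zero, map_one, Module.End.one_apply] at hn
    rw [hn, map_zero] at h
    exact not_lt_zero h
  | succ n ih =>
    rw [pow_succ, map_mul, Module.End.mul_apply] at hn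
    refine ih hn ?_
    have h1 : 1 < v x := lt_of_le_of_lt (le_max_left _ _) h
    have h2 : v (algebraMap Fq[X] E X) < v x := lt_of_le_of_lt (le_max_right _ _) h
    have h3 : v (algebraMap Fq[X] E X * x) < v (x ^ Fintype.card Fq) := by
      rw [map_mul, map_pow]
      calc v (algebraMap Fq[X] E X) * v x < v x * v x :=
            mul_lt_mul_of_pos_right h2 (zero_lt_one.trans h1)
        _ = v x ^ 2 := (sq _).symm
        _ ≤ v x ^ Fintype.card Fq := pow_le_pow_right₀ h1.le hq
    rw [carlitz_X_apply, Valuation.map_add_eq_of_lt_right _ h3, map_pow]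
    exact h.trans_le (le_self_pow₀ h1.le (by omega))

theorem valuation_algebraMap_eq [IsScalarTower Fq Fq[X] E]
    (hv : 1 < v (algebraMap Fq[X] E X)) {a : Fq[X]} (ha : a ≠ 0) :
    v (algebraMap Fq[X] E a) = v (algebraMap Fq[X] E X) ^ a.natDegree := by
  have := valuation_isTrivialOn (Fq := Fq) v
  rw [← valuation_aeval_eq_valuation_X_pow_natDegree_of_one_lt_valuation_X _ hv ha,
    aeval_algebraMap_apply, aeval_X_left_apply]

theorem valuation_algebraMap_le [IsScalarTower Fq Fq[X] E] (a : Fq[X]) :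
    v (algebraMap Fq[X] E a) ≤ thetaBound Fq v ^ a.natDegree := by
  have := valuation_isTrivialOn (Fq := Fq) v
  have h1 : 1 ≤ thetaBound Fq v := le_max_left _ _
  have hle : v (algebraMap Fq[X] E X) ≤ thetaBound Fq v := le_max_right _ _
  rw [← aeval_X_left_apply a, ← aeval_algebraMap_apply, aeval_eq_sum_range, aeval_X_left_apply]
  refine Valuation.map_sum_le _ fun i hi => ?_
  rw [Algebra.smul_def, map_mul, map_pow]
  have hc : v (algebraMap Fq E (a.coeff i)) ≤ 1 := by
    by_cases h : a.coeff i = 0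
    · simp [h]
    · exact (this.eq_one _ h).le
  calc _ ≤ 1 * thetaBound Fq v ^ i := mul_le_mul' hc (pow_le_pow_left' hle i)
    _ ≤ thetaBound Fq v ^ a.natDegree := by
      rw [one_mul]
      exact pow_le_pow_right₀ h1 (Nat.lt_succ_iff.1 (Finset.mem_range.1 hi))

/-- The point is uniformity: `N` depends on neither the place nor the point. Where `θ` is integral
the bound is 1, so the same lemma yields integrality of values. -/
theorem exists_valuation_aeval_le [IsScalarTower Fq Fq[X] E] {σ : Type*}
    (F : MvPolynomial σ Fq[X]) :
    ∃ N : ℕ, ∀ (V : ValuationSubring E) (y : σ → E),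
      (∀ j, V.valuation (y j) ≤ thetaBound Fq V.valuation) →
        V.valuation (MvPolynomial.aeval y F) ≤ thetaBound Fq V.valuation ^ N := by
  induction F using MvPolynomial.induction_on with
  | C a =>
    refine ⟨a.natDegree, fun V y _ => ?_⟩
    rw [MvPolynomial.aeval_C]
    exact valuation_algebraMap_le _ a
  | add p q hp hq =>
    obtain ⟨M, hM⟩ := hp
    obtain ⟨N, hN⟩ := hq
    refine ⟨max M N, fun V y hy => ?_⟩
    have h1 : 1 ≤ thetaBound Fq V.valuation := le_max_left _ _
    rw [map_add]
    exact Valuation.map_add_le _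
      ((hM V y hy).trans (pow_le_pow_right₀ h1 (le_max_left _ _)))
      ((hN V y hy).trans (pow_le_pow_right₀ h1 (le_max_right _ _)))
  | mul_X p j hp =>
    obtain ⟨M, hM⟩ := hp
    refine ⟨M + 1, fun V y hy => ?_⟩
    rw [map_mul, map_mul, MvPolynomial.aeval_X, pow_succ]
    exact mul_le_mul' (hM V y hy) (hy j)

end Valuation

end Torsion

/-! ### Vanishing of the coefficients for large `k`. -/

section Vanishing

variable {Fq : Type*} [Field Fq] [Fintype Fq] {σ : Type*}

theorem natDegree_carlitzD (i : ℕ) : (carlitzD Fq i).natDegree = i * Fintype.card Fq ^ i := by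
  induction i with
  | zero => simp [carlitzD]
  | succ i ih =>
    rw [carlitzD_succ, natDegree_mul (X_pow_card_pow_sub_X_ne_zero i)
      (pow_ne_zero _ (carlitzD_ne_zero i)), natDegree_pow, ih,
      FiniteField.X_pow_card_pow_sub_X_natDegree_eq _ i.succ_ne_zero Fintype.one_lt_card, Nat.succ_eq_add_one]
    ring

variable {E : Type*} [Field E] [Algebra Fq E] [Algebra Fq[X] E] [Algebra (RatFunc Fq) E]
  [IsScalarTower Fq Fq[X] E] [IsScalarTower Fq[X] (RatFunc Fq) E]

theorem aeval_carlitzSubst_map (x : σ → E) (a : Fq[X]) (F : MvPolynomial σ Fq[X]) :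
    MvPolynomial.aeval x (carlitzSubst (RatFunc Fq) a
      (MvPolynomial.map (algebraMap Fq[X] (RatFunc Fq)) F)) =
      MvPolynomial.aeval (fun j => carlitz Fq E a (x j)) F := by
  induction F using MvPolynomial.induction_on with
  | C c =>
    rw [MvPolynomial.map_C, carlitzSubst_C, MvPolynomial.aeval_C, MvPolynomial.aeval_C,
      ← IsScalarTower.algebraMap_apply]
  | add p q hp hq => simp only [map_add, hp, hq]
  | mul_X p j hp =>
    have h := map_carlitz ((MvPolynomial.aeval x : MvPolynomial σ (RatFunc Fq) →ₐ[RatFunc Fq]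
      E).restrictScalars Fq[X]) a (MvPolynomial.X j)
    simp only [AlgHom.restrictScalars_apply, MvPolynomial.aeval_X] at h
    rw [map_mul, map_mul, map_mul, hp, map_mul, MvPolynomial.map_X, carlitzSubst_X, h,
      MvPolynomial.aeval_X]

/-- Since `C_a` preserves torsion points, `F(C_a(x))` is bounded by `|θ| ^ N` independently of `a`,
and `1 / a` contributes `|θ| ^ (-j)`. -/
theorem valuation_aeval_starSum_le (F : MvPolynomial σ Fq[X]) {N : ℕ}
    (V : ValuationSubring E) (hV : 1 < V.valuation (algebraMap Fq[X] E X))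
    (hN : ∀ (y : σ → E), (∀ j, V.valuation (y j) ≤ thetaBound Fq V.valuation) →
      V.valuation (MvPolynomial.aeval y F) ≤ thetaBound Fq V.valuation ^ N)
    {x : σ → E} (hx : ∀ j, x j ∈ torsion Fq E) (j : ℕ) :
    V.valuation (MvPolynomial.aeval x
      (starSum (MvPolynomial.map (algebraMap Fq[X] (RatFunc Fq)) F) j)) ≤
      (V.valuation (algebraMap Fq[X] E X) ^ j)⁻¹ * V.valuation (algebraMap Fq[X] E X) ^ N := by
  have hb : thetaBound Fq V.valuation = V.valuation (algebraMap Fq[X] E X) := max_eq_right hV.le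
  rw [starSum, map_sum]
  refine Valuation.map_sum_le _ fun a ha => ?_
  rw [mem_monics] at ha
  rw [map_smul, Algebra.smul_def, map_mul, map_inv₀, ← IsScalarTower.algebraMap_apply, map_inv₀,
    valuation_algebraMap_eq _ hV ha.1.ne_zero, ha.2, aeval_carlitzSubst_map, ← hb]
  exact mul_le_mul_right (hN _ fun j => valuation_le_of_mem_torsion _
    (carlitz_mem_torsion a (hx j))) _

/-- As `D_i` has degree `i q ^ i`, the term with `i + j = k` is at most `(|θ| ^ (-i) |θ| ^ (N - j))
^ (q ^ i) = |θ| ^ ((N - k) q ^ i)`. -/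
theorem valuation_aeval_expSeq_lt_one (F : MvPolynomial σ Fq[X]) {N : ℕ}
    (V : ValuationSubring E) (hV : 1 < V.valuation (algebraMap Fq[X] E X))
    (hN : ∀ (y : σ → E), (∀ j, V.valuation (y j) ≤ thetaBound Fq V.valuation) →
      V.valuation (MvPolynomial.aeval y F) ≤ thetaBound Fq V.valuation ^ N)
    {x : σ → E} (hx : ∀ j, x j ∈ torsion Fq E) {k : ℕ} (hk : N < k) :
    V.valuation (MvPolynomial.aeval x (expSeq Fq σ
      (starSum (MvPolynomial.map (algebraMap Fq[X] (RatFunc Fq)) F)) k)) < 1 := by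
  rw [expSeq_apply, map_sum]
  refine Valuation.map_sum_lt _ one_ne_zero fun p hp => ?_
  rw [Finset.HasAntidiagonal.mem_antidiagonal] at hp
  set t := V.valuation (algebraMap Fq[X] E X) with ht
  have ht0 : t ≠ 0 := (zero_lt_one.trans hV).ne'
  have hq : Fintype.card Fq ^ p.1 ≠ 0 := pow_ne_zero _ Fintype.card_ne_zero
  rw [map_smul, Algebra.smul_def, map_mul, invD, map_inv₀, ← IsScalarTower.algebraMap_apply,
    map_inv₀, valuation_algebraMap_eq _ hV (carlitzD_ne_zero _), natDegree_carlitzD, map_pow,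
    map_pow, ← ht, pow_mul, ← inv_pow, ← mul_pow]
  refine pow_lt_one' ?_ hq
  calc _ ≤ (t ^ p.1)⁻¹ * ((t ^ p.2)⁻¹ * t ^ N) :=
        mul_le_mul_right (valuation_aeval_starSum_le F V hV hN hx p.2) _
    _ = t ^ N / t ^ k := by rw [← hp, pow_add]; field_simp
    _ < 1 := (div_lt_one₀ (pow_pos (zero_lt_one.trans hV) _)).2 (pow_lt_pow_right₀ hV hk)

end Vanishing

theorem expSeq_starSum_eventually_eq_zero {Fq : Type*} [Field Fq] [Fintype Fq] {σ : Type*}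
    (F : MvPolynomial σ Fq[X]) :
    ∃ N : ℕ, ∀ k, N < k →
      expSeq Fq σ (starSum (MvPolynomial.map (algebraMap Fq[X] (RatFunc Fq)) F)) k = 0 := by
  let E := AlgebraicClosure (RatFunc Fq)
  have hinj : Function.Injective (algebraMap Fq[X] E) := by
    rw [IsScalarTower.algebraMap_eq Fq[X] (RatFunc Fq) E]
    exact (algebraMap (RatFunc Fq) E).injective.comp (IsFractionRing.injective _ _)
  obtain ⟨N, hN⟩ := exists_valuation_aeval_le (E := E) F
  refine ⟨N, fun k hk => ?_⟩
  -- Passing to the algebraic closure provides infinitely many torsion points, on which a nonzero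
  -- polynomial cannot vanish identically.
  refine MvPolynomial.map_injective _ (algebraMap (RatFunc Fq) E).injective ?_
  rw [map_zero]
  refine MvPolynomial.funext_set (fun _ => torsion Fq E) (fun _ => torsion_infinite ?_)
    fun x hx => ?_
  · exact (map_ne_zero_iff _ hinj).2 X_ne_zero
  have hx' : ∀ j, x j ∈ torsion Fq E := fun j => hx j (Set.mem_univ j)
  rw [map_zero, MvPolynomial.eval_map, ← MvPolynomial.aeval_def]
  refine eq_zero_of_valuation_lt_one hinj
    (fun V hV => valuation_aeval_expSeq_lt_one F V hV (hN V) hx' hk) fun V hV => ?_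
  -- At places where `θ` is integral, so are the torsion points, and the coefficients of `f_k` lie
  -- in `A`.
  obtain ⟨G, hG⟩ := expSeq_starSum_integral F k
  obtain ⟨M, hM⟩ := exists_valuation_aeval_le (E := E) G
  have h := hM V x fun j => valuation_le_of_mem_torsion _ (hx' j)
  rw [thetaBound, max_eq_left hV, one_pow] at h
  rwa [hG, MvPolynomial.aeval_map_algebraMap]

end Carlitz

end

/-! ### Assembly of the polynomial. -/

theorem theorem4 (Fq : Type*) [Field Fq] [Fintype Fq] (s : ℕ)
    (F : MvPolynomial (Fin s) (Polynomial Fq)) :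
    ∃ P : Polynomial (MvPolynomial (Fin s) (Polynomial Fq)),
      Carlitz.logAlg (MvPolynomial.map (algebraMap (Polynomial Fq) (RatFunc Fq)) F) =
        ((P.map (MvPolynomial.map (algebraMap (Polynomial Fq) (RatFunc Fq))) :
          Polynomial (MvPolynomial (Fin s) (RatFunc Fq))) :
            PowerSeries (MvPolynomial (Fin s) (RatFunc Fq))) := by
  obtain ⟨N, hN⟩ := Carlitz.expSeq_starSum_eventually_eq_zero F
  choose G hG using Carlitz.expSeq_starSum_integral F
  have hinj := Nat.pow_right_injective (Fintype.one_lt_card (α := Fq))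
  refine ⟨∑ k ∈ Finset.range (N + 1), Polynomial.monomial (Fintype.card Fq ^ k) (G k), ?_⟩
  ext1 n
  rw [Polynomial.coeff_coe, Polynomial.coeff_map, Polynomial.finsetSum_coeff, map_sum]
  simp only [Polynomial.coeff_monomial]
  by_cases hn : ∃ j, n = Fintype.card Fq ^ j
  · obtain ⟨j, rfl⟩ := hn
    rw [Carlitz.coeff_logAlg]
    simp only [hinj.eq_iff]
    by_cases hj : j ≤ N
    · rw [Finset.sum_eq_single j]
      · rw [if_pos rfl, hG]
      · intro k _ hk
        rw [if_neg hk, map_zero]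
      · intro h
        exact absurd (Finset.mem_range.2 (Nat.lt_succ_iff.2 hj)) h
    · rw [hN j (not_le.1 hj), Finset.sum_eq_zero]
      intro k hk
      rw [Finset.mem_range] at hk
      rw [if_neg (by omega), map_zero]
  · push Not at hn
    rw [Carlitz.coeff_logAlg_of_ne _ hn, Finset.sum_eq_zero]
    intro k _
    rw [if_neg (hn k).symm, map_zero]
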